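/- Let $\mathbb{K}$ be a field with an automorphism $a\mapsto\overline{a}$ of order two and let $\mathbb{F}$ be its fixed field. Extend the involution to $\mathbb{K}[\mathbf{x}]=\mathbb{K}[x_1,\dots,x_m]$ by acting on coefficients. Call $q\in\mathbb{F}[\mathbf{x}]$ a Hermitian square in $\mathbb{K}[\mathbf{x}]$ if $q=g\overline{g}$ for some $g\in\mathbb{K}[\mathbf{x}]$. Write $v^*=\overline{v}^T$, and call a square matrix $W$ over $\mathbb{K}$ Hermitian if $W=\overline{W}^T$. For $f\in\mathbb{F}[\mathbf{x}]$ and $i,j\in\{1,\dots,m\}$ put $$\Delta_{ij}(f)=\frac{\partial f}{\partial x_i}\frac{\partial f}{\partial x_j}-f\,\frac{\partial^2 f}{\partial x_i\partial x_j}.$$ Say that $f$ has a determinantal representation of size $n\ge 0$ if $$f=\lambda\det\Big(\sum_{i=1}^m x_i\,v_iv_i^*+W\Big)$$ for some $\lambda\in\mathbb{F}$, some $v_1,\dots,v_m\in\mathbb{K}^n$ and some Hermitian $W\in\mathbb{K}^{n\times n}$ (a determinant of size $0$ is $1$). Let $f\in\mathbb{F}[x_1,\dots,x_m]$ be multiaffine,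 i.e. of degree at most one in each variable. Then $f$ has a determinantal representation of some size $n$ if and only if $\Delta_{ij}(f)$ is a Hermitian square in $\mathbb{K}[\mathbf{x}]$ for all $i,j\in\{1,\dots,m\}$. Moreover, whenever $f$ has a determinantal representation, it has one of size $n=\deg(f)$ (with $\deg(0)=0$). -/

import Mathlib

open MvPolynomial

/-- A polynomial is multiaffine if it has degree at most one in each variable. -/
def IsMultiaffine {F : Type*} [Field F] {m : ℕ} (f : MvPolynomial (Fin m) F) : Prop :=
  ∀ i : Fin m, f.degreeOf i ≤ 1

/-- The Rayleigh difference `Δᵢⱼ(f) = ∂ᵢf · ∂ⱼf - f · ∂ᵢ∂ⱼf`. -/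
noncomputable def rayleighDiff {F : Type*} [Field F] {m : ℕ} (i j : Fin m)
    (f : MvPolynomial (Fin m) F) : MvPolynomial (Fin m) F :=
  pderiv i f * pderiv j f - f * pderiv i (pderiv j f)

/-- `q ∈ F[x]` is a Hermitian square over `K` if `q = g * ḡ` for some `g ∈ K[x]`, where `ḡ` is
obtained by applying the involution `star` of `K` to the coefficients of `g`. -/
def IsHermitianSquare (K : Type*) {F : Type*} [Field F] [Field K] [Algebra F K] [StarRing K]
    {m : ℕ} (q : MvPolynomial (Fin m) F) : Prop :=
  ∃ g : MvPolynomial (Fin m) K,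
    MvPolynomial.map (algebraMap F K) q = g * MvPolynomial.map (starRingEnd K) g

/-- `f = lam * det (∑ i, x i • v i (v i)^* + W)` with `lam ∈ F`, column vectors `v i ∈ K^n`, and
`W` an `n × n` Hermitian matrix over `K`. Here `Matrix.vecMulVec (v i) (star (v i))` is the
rank-one matrix `v i (v i)^*`; the determinant is taken over `K[x]`. -/
def HasHermitianDetRep (K : Type*) {F : Type*} [Field F] [Field K] [Algebra F K] [StarRing K]
    {m : ℕ} (f : MvPolynomial (Fin m) F) (n : ℕ) : Prop :=
  ∃ (lam : F) (v : Fin m → Fin n → K) (W : Matrix (Fin n) (Fin n) K), W.IsHermitian ∧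
    MvPolynomial.map (algebraMap F K) f =
      C (algebraMap F K lam) *
        Matrix.det (∑ i : Fin m,
            (X i : MvPolynomial (Fin m) K) • (Matrix.vecMulVec (v i) (star (v i))).map C
          + W.map C)

/-! Necessity. Let `M` be the pencil. As `f` is multiaffine, raising `x_i` by one turns `f` into `f
+ ∂_i f` and `M` into `M + v_i v_i^*`. A Dodgson-type identity for such updates
(`det_mul_det_add_vecMulVec`) gives `Δ_ij(f) = λ² (v_i^* adj(M) v_j)(v_j^* adj(M) v_i)`, whose two
bracketed factors are conjugate.

Sufficiency. The matrix `λ v_i^* adj(M) v_j` is rebuilt from `f` alone. A nonzero `f` is nonzero at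
some point of `F^m`, so translation and scaling make its constant term 1. Its irreducible factors
over `K`, normalised likewise, are fixed by conjugation, have disjoint variables, and inherit the
hypothesis by unique factorisation. For prime `f`, `exists_insert` builds index by index a Hermitian
matrix `g` with diagonal `∂_i f`, `g_ij g_ji = Δ_ij` and rank at most one modulo `f`. Then `G = g/f`
satisfies `∂_l G_ij = -G_il G_lj`, the equation of `A(1 + DA)⁻¹` with `D = diag(x)`; hence `f =
det(1 + DA)` with `A = g(0)` (`restrictTo_eq_det`). Writing `A = P B P^*` with `B` invertible
compresses this to a pencil of size `rank A = deg f`. -/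

/-! ### Multiaffine polynomials and Rayleigh differences. -/

section Basics

variable {K : Type*} [Field K] {m : ℕ}

/-- The substitution `x_l ↦ 0`. -/
noncomputable def zeroAt (l : Fin m) : MvPolynomial (Fin m) K →ₐ[K] MvPolynomial (Fin m) K :=
  aeval (Function.update X l 0)

lemma eq_zeroAt_add {p : MvPolynomial (Fin m) K} {l : Fin m} (h : p.degreeOf l ≤ 1) :
    p = zeroAt l p + X l * pderiv l p := by
  rw [degreeOf_le_iff] at h
  have key : ∀ s ∈ p.support, monomial s (p.coeff s) =
      zeroAt l (monomial s (p.coeff s)) + X l * pderiv l (monomial s (p.coeff s)) := by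
    intro s hs
    have h1 := h s hs
    rw [X_mul_pderiv_monomial, zeroAt, aeval_monomial, Finsupp.prod_fintype _ _ (by simp)]
    by_cases h0 : s l = 0
    · rw [h0, zero_smul, add_zero, monomial_eq, Finsupp.prod_fintype _ _ (by simp)]
      congr 1
      refine Finset.prod_congr rfl fun i _ => ?_
      by_cases hi : i = l
      · subst hi; simp [h0]
      · rw [Function.update_of_ne hi]
    · have h2 : s l = 1 := by omega
      rw [Finset.prod_eq_zero (Finset.mem_univ l) (by simp [h2]), h2]
      simp
  conv_lhs => rw [p.as_sum]
  conv_rhs => rw [p.as_sum]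
  rw [map_sum, map_sum, Finset.mul_sum, ← Finset.sum_add_distrib]
  exact Finset.sum_congr rfl key

lemma degreeOf_pderiv_le (k l : Fin m) (p : MvPolynomial (Fin m) K) :
    (pderiv l p).degreeOf k ≤ p.degreeOf k := by
  rw [degreeOf_le_iff]
  intro s hs
  rw [mem_support_iff, coeff_pderiv] at hs
  have h := monomial_le_degreeOf k (mem_support_iff.2 (left_ne_zero_of_mul hs))
  simp only [Finsupp.add_apply] at h
  omega

lemma degreeOf_pderiv_self {l : Fin m} {p : MvPolynomial (Fin m) K} (h : p.degreeOf l ≤ 1) :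
    (pderiv l p).degreeOf l = 0 := by
  rw [← Nat.le_zero, degreeOf_le_iff]
  intro s hs
  rw [mem_support_iff, coeff_pderiv] at hs
  have h := monomial_le_degreeOf l (mem_support_iff.2 (left_ne_zero_of_mul hs))
  simp only [Finsupp.add_apply, Finsupp.single_eq_same] at h
  omega

lemma pderiv_eq_zero_of_degreeOf_eq_zero {l : Fin m} {p : MvPolynomial (Fin m) K}
    (h : p.degreeOf l = 0) : pderiv l p = 0 :=
  pderiv_eq_zero_of_notMem_vars fun h' => mem_vars_iff_degreeOf_ne_zero.1 h' h

lemma zeroAt_of_degreeOf_eq_zero {l : Fin m} {p : MvPolynomial (Fin m) K}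
    (h : p.degreeOf l = 0) : zeroAt l p = p := by
  have := eq_zeroAt_add (p := p) (l := l) (by omega)
  rw [pderiv_eq_zero_of_degreeOf_eq_zero h, mul_zero, add_zero] at this
  exact this.symm

lemma zeroAt_zeroAt (l : Fin m) (p : MvPolynomial (Fin m) K) :
    zeroAt l (zeroAt l p) = zeroAt l p := by
  rw [← AlgHom.comp_apply]
  congr 1
  ext i
  by_cases h : i = l
  · subst h; simp [zeroAt]
  · simp [zeroAt, h]

lemma degreeOf_eq_zero_of_zeroAt {l : Fin m} {p : MvPolynomial (Fin m) K}
    (h : zeroAt l p = p) : p.degreeOf l = 0 := by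
  rw [← h, ← Nat.le_zero]
  rw [zeroAt, p.as_sum, map_sum]
  refine (degreeOf_sum_le _ _ _).trans (Finset.sup_le fun s _ => ?_)
  rw [aeval_monomial, Finsupp.prod_fintype _ _ (by simp)]
  refine (degreeOf_C_mul_le _ _ _).trans ((degreeOf_prod_le _ _ _).trans ?_)
  rw [Nat.le_zero, Finset.sum_eq_zero_iff]
  intro i _
  rw [← Nat.le_zero]
  refine (degreeOf_pow_le _ _ _).trans ?_
  by_cases hi : i = l
  · subst hi; simp
  · rw [Function.update_of_ne hi, degreeOf_X_of_ne (Ne.symm hi), mul_zero]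

/-- The degree bound is what makes this valid in positive characteristic. -/
lemma degreeOf_eq_zero_of_pderiv_eq_zero {l : Fin m} {p : MvPolynomial (Fin m) K}
    (h : p.degreeOf l ≤ 1) (h0 : pderiv l p = 0) : p.degreeOf l = 0 := by
  apply degreeOf_eq_zero_of_zeroAt
  conv_rhs => rw [eq_zeroAt_add h, h0, mul_zero, add_zero]

lemma zeroAt_eq_sub {l : Fin m} {p : MvPolynomial (Fin m) K} (h : p.degreeOf l ≤ 1) :
    zeroAt l p = p - X l * pderiv l p :=
  eq_sub_of_add_eq (eq_zeroAt_add h).symm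

lemma zeroAt_pderiv_self {l : Fin m} {p : MvPolynomial (Fin m) K} (h : p.degreeOf l ≤ 1) :
    zeroAt l (pderiv l p) = pderiv l p :=
  zeroAt_of_degreeOf_eq_zero (degreeOf_pderiv_self h)

lemma pderiv_pderiv_comm (i j : Fin m) (p : MvPolynomial (Fin m) K) :
    pderiv i (pderiv j p) = pderiv j (pderiv i p) := by
  ext s
  simp only [coeff_pderiv]
  by_cases h : i = j
  · subst h; rfl
  · rw [add_right_comm s, Finsupp.add_apply, Finsupp.add_apply,
      Finsupp.single_eq_of_ne (Ne.symm h), Finsupp.single_eq_of_ne h]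
    simp only [add_zero]
    ring

lemma degreeOf_map_of_injective {F : Type*} [Field F] (φ : F →+* K) (l : Fin m)
    (p : MvPolynomial (Fin m) F) : (map φ p).degreeOf l = p.degreeOf l := by
  rw [degreeOf_eq_sup, degreeOf_eq_sup, support_map_of_injective _ φ.injective]

/-- A nonzero multiple of `f` involves every variable of `f`. This turns congruences modulo `f` into
equalities. -/
lemma eq_zero_of_dvd_of_degreeOf {f q : MvPolynomial (Fin m) K} {l : Fin m}
    (hf : pderiv l f ≠ 0) (hd : f ∣ q) (hq : q.degreeOf l = 0) : q = 0 := by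
  by_contra h
  obtain ⟨r, rfl⟩ := hd
  rw [degreeOf_mul_eq (left_ne_zero_of_mul h) (right_ne_zero_of_mul h)] at hq
  exact hf (pderiv_eq_zero_of_degreeOf_eq_zero (by omega))

/-- The two products have the same coefficient `∂_i f · ∂_i ∂_j f` at `x_i`, so `x_i` cancels. -/
lemma rayleighDiff_zeroAt {i j : Fin m} {f : MvPolynomial (Fin m) K}
    (hf : IsMultiaffine f) : zeroAt i (rayleighDiff i j f) = rayleighDiff i j f := by
  have h1 : (pderiv j f).degreeOf i ≤ 1 := (degreeOf_pderiv_le _ _ _).trans (hf i)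
  rw [rayleighDiff, map_sub, map_mul, map_mul, zeroAt_pderiv_self (hf i), zeroAt_pderiv_self h1,
    zeroAt_eq_sub h1, zeroAt_eq_sub (hf i)]
  ring

lemma rayleighDiff_comm (i j : Fin m) (f : MvPolynomial (Fin m) K) :
    rayleighDiff i j f = rayleighDiff j i f := by
  rw [rayleighDiff, rayleighDiff, pderiv_pderiv_comm, mul_comm (pderiv i f)]

lemma rayleighDiff_self {i : Fin m} {f : MvPolynomial (Fin m) K} (hf : IsMultiaffine f) :
    rayleighDiff i i f = pderiv i f * pderiv i f := by
  rw [rayleighDiff, pderiv_eq_zero_of_degreeOf_eq_zero (degreeOf_pderiv_self (hf i)), mul_zero,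
    sub_zero]

lemma rayleighDiff_of_pderiv_eq_zero {i j : Fin m} {f : MvPolynomial (Fin m) K}
    (h : pderiv i f = 0) : rayleighDiff i j f = 0 := by
  rw [rayleighDiff, pderiv_pderiv_comm, h]; simp

lemma degreeOf_rayleighDiff_left {i j : Fin m} {f : MvPolynomial (Fin m) K}
    (hf : IsMultiaffine f) : (rayleighDiff i j f).degreeOf i = 0 :=
  degreeOf_eq_zero_of_zeroAt (rayleighDiff_zeroAt hf)

lemma degreeOf_rayleighDiff_right {i j : Fin m} {f : MvPolynomial (Fin m) K}
    (hf : IsMultiaffine f) : (rayleighDiff i j f).degreeOf j = 0 := by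
  rw [rayleighDiff_comm]
  exact degreeOf_rayleighDiff_left hf

lemma degreeOf_rayleighDiff_le (i j k : Fin m) {f : MvPolynomial (Fin m) K}
    (hf : IsMultiaffine f) : (rayleighDiff i j f).degreeOf k ≤ 2 := by
  have h0 := hf k
  have h1 := degreeOf_pderiv_le k i f
  have h2 := degreeOf_pderiv_le k j f
  have h3 := degreeOf_pderiv_le k i (pderiv j f)
  refine (degreeOf_sub_le _ _ _).trans (max_le ?_ ?_) <;>
  exact (degreeOf_mul_le _ _ _).trans (by omega)

end Basics

/-! ### Norms and rank-one Hermitian matrices over a factorial ring with involution. -/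

section Norm

variable {R : Type*} [CommRing R] [IsDomain R] [UniqueFactorizationMonoid R]

/-- If a norm `a * σ a` times `d` is a norm, then so is `d`. -/
lemma exists_norm_of_mul_norm (σ : R →+* R) (hσ : ∀ x, σ (σ x) = x) {a : R} (ha : a ≠ 0) :
    ∀ {d h : R}, d * (a * σ a) = h * σ h → ∃ e, d = e * σ e := by
  induction a using UniqueFactorizationMonoid.induction_on_prime with
  | h₁ => exact absurd rfl ha
  | h₂ u hu =>
    intro d h hd
    obtain ⟨v, hv⟩ := hu.exists_right_inv
    refine ⟨h * v, ?_⟩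
    have hv' : σ u * σ v = 1 := by rw [← map_mul, hv, map_one]
    rw [map_mul]
    linear_combination (v * σ v) * hd - d * (u * v * hv' + hv)
  | h₃ a p ha' hp ih =>
    intro d h hd
    have hp0 : p * σ p ≠ 0 :=
      mul_ne_zero hp.ne_zero fun h0 => hp.ne_zero (by rw [← hσ p, h0, map_zero])
    rw [map_mul] at hd
    -- Either `p` or `σ p` divides `h`; in both cases `p * σ p` cancels from the norm.
    have hdvd : p ∣ h * σ h := ⟨d * (a * (σ p * σ a)), by rw [← hd]; ring⟩
    rcases hp.dvd_or_dvd hdvd with ⟨q, rfl⟩ | ⟨q, hq⟩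
    · refine ih ha' (d := d) (h := q) (mul_left_cancel₀ hp0 ?_)
      rw [map_mul] at hd
      linear_combination hd
    · have hh : h = σ p * σ q := by rw [← map_mul, ← hq, hσ]
      refine ih ha' (d := d) (h := σ q) (mul_left_cancel₀ hp0 ?_)
      rw [hh, map_mul, hσ, hσ] at hd
      rw [hσ]
      linear_combination hd

/-- If a Hermitian matrix `H` times a norm has the form `b b^*`, then so does `H`. -/
lemma exists_vec_of_norm_mul {ι : Type*} (σ : R →+* R) (hσ : ∀ x, σ (σ x) = x)
    (H : ι → ι → R) {h : R} (hh : h ≠ 0) :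
    ∀ {b : ι → R}, (∀ i j, h * σ h * H i j = b i * σ (b j)) →
      ∃ c : ι → R, ∀ i j, H i j = c i * σ (c j) := by
  induction h using UniqueFactorizationMonoid.induction_on_prime with
  | h₁ => exact absurd rfl hh
  | h₂ u hu =>
    intro b hb
    obtain ⟨v, hv⟩ := hu.exists_right_inv
    have hv' : σ u * σ v = 1 := by rw [← map_mul, hv, map_one]
    refine ⟨fun i => b i * v, fun i j => ?_⟩
    rw [map_mul]
    linear_combination (v * σ v) * hb i j - H i j * (u * v * hv' + hv)
  | h₃ a p ha' hp ih =>
    intro b hb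
    have hp0 : p * σ p ≠ 0 :=
      mul_ne_zero hp.ne_zero fun h0 => hp.ne_zero (by rw [← hσ p, h0, map_zero])
    by_cases hall : ∀ i, p ∣ b i
    · choose q hq using hall
      refine ih ha' (b := q) fun i j => mul_left_cancel₀ hp0 ?_
      have := hb i j
      rw [hq i, hq j, map_mul, map_mul] at this
      linear_combination this
    -- One entry `b i₀` prime to `p` forces `p` to divide every `σ (b j)`, so `σ p` divides all of
    -- `b` and is removed instead.
    · push Not at hall
      obtain ⟨i₀, hi₀⟩ := hall
      have hdvd : ∀ j, p ∣ σ (b j) := fun j =>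
        (hp.dvd_or_dvd (⟨a * (σ (p * a)) * H i₀ j, by rw [← hb i₀ j]; ring⟩ :
          p ∣ b i₀ * σ (b j))).resolve_left hi₀
      choose q hq using hdvd
      refine ih ha' (b := fun i => σ (q i)) fun i j => mul_left_cancel₀ hp0 ?_
      have := hb i j
      have hbi : b i = σ p * σ (q i) := by rw [← map_mul, ← hq, hσ]
      rw [hq j, hbi, map_mul] at this
      rw [hσ]
      linear_combination this

/-- A rank-one Hermitian matrix `H` with norms on the diagonal has the form `c c^*`. -/
lemma exists_vec_of_rank_one {ι : Type*} (σ : R →+* R) (hσ : ∀ x, σ (σ x) = x)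
    (H : ι → ι → R) (hH : ∀ i j, σ (H i j) = H j i)
    (hr : ∀ i j k l, H i j * H k l = H i l * H k j)
    (hd : ∀ i, ∃ h, H i i = h * σ h) :
    ∃ c : ι → R, ∀ i j, H i j = c i * σ (c j) := by
  -- With zero diagonal, `H i j * H j i = 0` kills `H`. Otherwise `H k k * H i j = H i k * σ (H j
  -- k)` for some `H k k ≠ 0`, which is a norm.
  by_cases h0 : ∀ i, H i i = 0
  · refine ⟨fun _ => 0, fun i j => ?_⟩
    have := hr i j j i
    rw [h0, h0, mul_zero] at this
    rcases mul_eq_zero.1 this with h | h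
    · rw [h, zero_mul]
    · rw [← hH, h, map_zero, zero_mul]
  · push Not at h0
    obtain ⟨k, hk⟩ := h0
    obtain ⟨h, hkk⟩ := hd k
    rw [hkk] at hk
    refine exists_vec_of_norm_mul σ hσ H (left_ne_zero_of_mul hk) (b := fun i => H i k) ?_
    intro i j
    rw [hH, ← hkk, mul_comm, hr, mul_comm, mul_comm]

end Norm

/-! ### Hermitian systems and their differential equation. -/

section Conj

variable {K : Type*} [Field K] [StarRing K] {m : ℕ}

lemma map_star_map_star (p : MvPolynomial (Fin m) K) :
    map (starRingEnd K) (map (starRingEnd K) p) = p := by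
  rw [map_map]
  convert map_id p
  ext x
  simp

lemma degreeOf_le_of_mul_star {g q : MvPolynomial (Fin m) K} (h : g * map (starRingEnd K) g = q)
    (l : Fin m) : 2 * g.degreeOf l = q.degreeOf l := by
  by_cases hg : g = 0
  · subst hg; simp [← h]
  · have hg' : map (starRingEnd K) g ≠ 0 :=
      fun h0 => hg (by rw [← map_star_map_star g, h0, map_zero])
    rw [← h, degreeOf_mul_eq hg hg', degreeOf_map_of_injective, two_mul]

/-- A partial Hermitian "adjugate" of `f` on the index set `T`: a Hermitian matrix of polynomials
with diagonal `∂ᵢf` and off-diagonal norms `Δᵢⱼ(f)`, having rank at most one modulo `f`. -/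
structure IsHermitianSystem (f : MvPolynomial (Fin m) K) (T : Finset (Fin m))
    (g : Fin m → Fin m → MvPolynomial (Fin m) K) : Prop where
  diag : ∀ i ∈ T, g i i = pderiv i f
  star : ∀ i ∈ T, ∀ j ∈ T, map (starRingEnd K) (g i j) = g j i
  norm : ∀ i ∈ T, ∀ j ∈ T, g i j * g j i = rayleighDiff i j f
  minor : ∀ i ∈ T, ∀ j ∈ T, ∀ k ∈ T, ∀ l ∈ T, f ∣ g i j * g k l - g i l * g k j

namespace IsHermitianSystem

variable {f : MvPolynomial (Fin m) K} {T : Finset (Fin m)}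
  {g : Fin m → Fin m → MvPolynomial (Fin m) K}

lemma norm_star (hg : IsHermitianSystem f T g) {i j : Fin m} (hi : i ∈ T) (hj : j ∈ T) :
    g i j * map (starRingEnd K) (g i j) = rayleighDiff i j f := by
  rw [hg.star i hi j hj, hg.norm i hi j hj]

lemma degreeOf_left (hg : IsHermitianSystem f T g) (hf : IsMultiaffine f) {i j : Fin m}
    (hi : i ∈ T) (hj : j ∈ T) : (g i j).degreeOf i = 0 := by
  have := degreeOf_le_of_mul_star (hg.norm_star hi hj) i
  rw [degreeOf_rayleighDiff_left hf] at this
  omega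

lemma degreeOf_right (hg : IsHermitianSystem f T g) (hf : IsMultiaffine f) {i j : Fin m}
    (hi : i ∈ T) (hj : j ∈ T) : (g i j).degreeOf j = 0 := by
  have := degreeOf_le_of_mul_star (hg.norm_star hi hj) j
  rw [degreeOf_rayleighDiff_right hf] at this
  omega

lemma degreeOf_le (hg : IsHermitianSystem f T g) (hf : IsMultiaffine f) {i j : Fin m}
    (hi : i ∈ T) (hj : j ∈ T) (k : Fin m) : (g i j).degreeOf k ≤ 1 := by
  have := degreeOf_le_of_mul_star (hg.norm_star hi hj) k
  have := degreeOf_rayleighDiff_le i j k hf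
  omega

lemma eq_zero_of_pderiv_left (hg : IsHermitianSystem f T g) {i j : Fin m}
    (hi : i ∈ T) (hj : j ∈ T) (h : pderiv i f = 0) : g i j = 0 := by
  have h1 := hg.norm_star hi hj
  rw [rayleighDiff_of_pderiv_eq_zero h] at h1
  rcases mul_eq_zero.1 h1 with h2 | h2
  · exact h2
  · rw [← map_star_map_star (g i j), h2, map_zero]

lemma eq_zero_of_pderiv_right (hg : IsHermitianSystem f T g) {i j : Fin m}
    (hi : i ∈ T) (hj : j ∈ T) (h : pderiv j f = 0) : g i j = 0 := by
  rw [← hg.star j hj i hi, hg.eq_zero_of_pderiv_left hj hi h, map_zero]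

lemma pderiv_eq_zero (hg : IsHermitianSystem f T g) (hf : IsMultiaffine f) {i j l : Fin m}
    (hi : i ∈ T) (hj : j ∈ T) (h0 : pderiv l f = 0) : pderiv l (g i j) = 0 := by
  have h1 := degreeOf_le_of_mul_star (hg.norm_star hi hj) l
  have h2 : (rayleighDiff i j f).degreeOf l = 0 := by
    have hfl := degreeOf_eq_zero_of_pderiv_eq_zero (hf l) h0
    have h2 := degreeOf_pderiv_le l i f
    have h3 := degreeOf_pderiv_le l j f
    have h4 := degreeOf_pderiv_le l i (pderiv j f)
    rw [← Nat.le_zero]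
    refine (degreeOf_sub_le _ _ _).trans (max_le ?_ ?_) <;>
    exact (degreeOf_mul_le _ _ _).trans (by omega)
  exact pderiv_eq_zero_of_degreeOf_eq_zero (by omega)

/-- The differential equation satisfied by the entries `g i j / f` of an inverse matrix. -/
lemma mul_pderiv (hg : IsHermitianSystem f T g) (hf : IsMultiaffine f) {i j l : Fin m}
    (hi : i ∈ T) (hj : j ∈ T) (hl : l ∈ T) :
    f * pderiv l (g i j) = pderiv l f * g i j - g i l * g l j := by
  have hdeg := hg.degreeOf_le hf hi hj l
  by_cases h0 : pderiv l f = 0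
  · rw [hg.pderiv_eq_zero hf hi hj h0, h0,
      hg.eq_zero_of_pderiv_right hi hl h0]
    simp
  -- The difference of the two sides is divisible by `f` but free of `x_l`, which occurs in `f`; so
  -- it vanishes.
  · have hdvd : f ∣ f * pderiv l (g i j) - (pderiv l f * g i j - g i l * g l j) := by
      have h := hg.minor i hi j hj l hl l hl
      rw [hg.diag l hl] at h
      have h2 := dvd_sub (dvd_mul_right f (pderiv l (g i j))) h
      rwa [mul_comm (g i j)] at h2
    refine sub_eq_zero.1 (eq_zero_of_dvd_of_degreeOf h0 hdvd (degreeOf_eq_zero_of_zeroAt ?_))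
    simp only [map_sub, map_mul]
    rw [zeroAt_pderiv_self hdeg, zeroAt_pderiv_self (hf l), zeroAt_eq_sub hdeg,
      zeroAt_eq_sub (hf l), zeroAt_of_degreeOf_eq_zero (hg.degreeOf_right hf hi hl),
      zeroAt_of_degreeOf_eq_zero (hg.degreeOf_left hf hl hj)]
    ring

end IsHermitianSystem

end Conj

/-! ### Adding an index to a Hermitian system. -/

section Extend

variable {K : Type*} [Field K] [StarRing K] {m : ℕ}

namespace IsHermitianSystem

variable {f : MvPolynomial (Fin m) K} {T : Finset (Fin m)}
  {g : Fin m → Fin m → MvPolynomial (Fin m) K}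

/-- The matrix which has to be of the form `c c^*` when a new index is added to `T`. -/
lemma exists_border (hg : IsHermitianSystem f T g) (hf : IsMultiaffine f)
    (hfs : map (starRingEnd K) f = f) {a : Fin m}
    (hsq : ∀ i ∈ T, ∃ h, rayleighDiff i a f = h * map (starRingEnd K) h) :
    ∃ c : Fin m → MvPolynomial (Fin m) K, ∀ i ∈ T, ∀ j ∈ T,
      pderiv a f * g i j - f * pderiv a (g i j) = c i * map (starRingEnd K) (c j) := by
  set H : T → T → MvPolynomial (Fin m) K :=
    fun i j => pderiv a f * g i j - f * pderiv a (g i j) with hHdef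
  -- As `f` and `g i j` are affine in `x_a`, the `x_a` terms of `H` cancel.
  have hdeg : ∀ i j, zeroAt a (H i j) = H i j := by
    intro i j
    have h1 := hg.degreeOf_le hf i.2 j.2 a
    simp only [hHdef, map_sub, map_mul]
    rw [zeroAt_pderiv_self (hf a), zeroAt_pderiv_self h1, zeroAt_eq_sub (hf a), zeroAt_eq_sub h1]
    ring
  have hHs : ∀ i j, map (starRingEnd K) (H i j) = H j i := by
    intro i j
    simp only [hHdef, map_sub, map_mul]
    rw [← pderiv_map, ← pderiv_map, hfs, hg.star i i.2 j j.2]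
  have hHd : ∀ i, H i i = rayleighDiff (i : Fin m) a f := by
    intro i
    simp only [hHdef]
    rw [hg.diag i i.2, rayleighDiff, pderiv_pderiv_comm]
    ring
  have hr : ∀ i j k l, H i j * H k l = H i l * H k j := by
    intro i j k l
    by_cases h0 : pderiv a f = 0
    · have hz : ∀ i j, H i j = 0 := fun i j => by
        simp only [hHdef]
        rw [h0, hg.pderiv_eq_zero hf i.2 j.2 h0]
        simp
      simp [hz]
    -- Modulo `f`, `H` is `∂_a f` times `g`, so its minors inherit divisibility; being free of
    -- `x_a`, they are zero.
    · have hd : f ∣ H i j * H k l - H i l * H k j := by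
        obtain ⟨q, hq⟩ := hg.minor i i.2 j j.2 k k.2 l l.2
        refine ⟨pderiv a f ^ 2 * q - pderiv a f * (g i j * pderiv a (g k l) +
          pderiv a (g i j) * g k l - g i l * pderiv a (g k j) - pderiv a (g i l) * g k j) +
          f * (pderiv a (g i j) * pderiv a (g k l) - pderiv a (g i l) * pderiv a (g k j)), ?_⟩
        simp only [hHdef]
        linear_combination (pderiv a f) ^ 2 * hq
      refine sub_eq_zero.1 (eq_zero_of_dvd_of_degreeOf h0 hd (degreeOf_eq_zero_of_zeroAt ?_))
      simp only [map_sub, map_mul, hdeg]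
  obtain ⟨c, hc⟩ := exists_vec_of_rank_one (map (starRingEnd K)) map_star_map_star H hHs hr
    (fun i => by rw [hHd]; exact hsq i i.2)
  refine ⟨fun i => if h : i ∈ T then c ⟨i, h⟩ else 0, fun i hi j hj => ?_⟩
  simp only [dif_pos hi, dif_pos hj]
  exact hc ⟨i, hi⟩ ⟨j, hj⟩

/-- The vector `c` of `exists_border` becomes the new column and its conjugate the new row.
Primality of `f` is needed for the minors that meet this border only once. -/
lemma exists_insert (hg : IsHermitianSystem f T g) (hf : IsMultiaffine f) (hp : Prime f)
    (hfs : map (starRingEnd K) f = f) {a : Fin m} (ha : a ∉ T)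
    (hsq : ∀ i j, i ≠ j → ∃ h, rayleighDiff i j f = h * map (starRingEnd K) h) :
    ∃ g', IsHermitianSystem f (insert a T) g' := by
  have hne : ∀ i ∈ T, i ≠ a := fun i hi h => ha (h ▸ hi)
  obtain ⟨c, hc⟩ := hg.exists_border hf hfs (fun i hi => hsq i a (hne i hi))
  have hcc : ∀ i ∈ T, c i * map (starRingEnd K) (c i) = rayleighDiff i a f := by
    intro i hi
    rw [← hc i hi i hi, hg.diag i hi, rayleighDiff, pderiv_pderiv_comm]
    ring
  have hB : ∀ i ∈ T, ∀ k ∈ T, ∀ j ∈ T, f ∣ g i j * c k - c i * g k j := by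
    intro i hi k hk j hj
    by_cases h0 : ∀ l ∈ T, c l = 0
    · simp [h0 i hi, h0 k hk]
    · push Not at h0
      obtain ⟨l, hl, hl0⟩ := h0
      have hl0' : map (starRingEnd K) (c l) ≠ 0 :=
        fun h => hl0 (by rw [← map_star_map_star (c l), h, map_zero])
      have hfa : pderiv a f ≠ 0 := by
        intro h
        have := hcc l hl
        rw [rayleighDiff_comm, rayleighDiff_of_pderiv_eq_zero h] at this
        exact mul_ne_zero hl0 hl0' this
      -- Modulo `f`, `c k` times the conjugate of `c l` is `∂_a f * g k l`, which reduces the claim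
      -- to an old minor. The factor removed afterwards is free of `x_a`, so `f` does not divide it.
      have hdvd : f ∣ map (starRingEnd K) (c l) * (g i j * c k - c i * g k j) := by
        obtain ⟨q, hq⟩ := hg.minor i hi j hj k hk l hl
        refine ⟨pderiv a f * q - g i j * pderiv a (g k l) + g k j * pderiv a (g i l), ?_⟩
        linear_combination pderiv a f * hq - g i j * hc k hk l hl + g k j * hc i hi l hl
      refine (hp.dvd_or_dvd hdvd).resolve_left fun h => hl0' (eq_zero_of_dvd_of_degreeOf hfa h ?_)
      have h1 := degreeOf_le_of_mul_star (hcc l hl) a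
      rw [degreeOf_rayleighDiff_right hf] at h1
      rw [degreeOf_map_of_injective]
      omega
  have hB' : ∀ i ∈ T, ∀ k ∈ T, ∀ j ∈ T,
      f ∣ g j i * map (starRingEnd K) (c k) - map (starRingEnd K) (c i) * g j k := by
    intro i hi k hk j hj
    have h := map_dvd (map (starRingEnd K)) (hB i hi k hk j hj)
    rwa [hfs, map_sub, map_mul, map_mul, hg.star i hi j hj, hg.star k hk j hj] at h
  have hD : ∀ i ∈ T, ∀ j ∈ T, f ∣ pderiv a f * g i j - c i * map (starRingEnd K) (c j) :=
    fun i hi j hj => ⟨pderiv a (g i j), by rw [← hc i hi j hj]; ring⟩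
  obtain ⟨g', haa, hai, hia, hij⟩ : ∃ g' : Fin m → Fin m → MvPolynomial (Fin m) K,
      g' a a = pderiv a f ∧ (∀ j ∈ T, g' a j = map (starRingEnd K) (c j)) ∧
      (∀ i ∈ T, g' i a = c i) ∧ ∀ i ∈ T, ∀ j ∈ T, g' i j = g i j := by
    refine ⟨fun i j => if i = a then (if j = a then pderiv a f else map (starRingEnd K) (c j))
      else if j = a then c i else g i j, by simp, fun j hj => by simp [hne j hj],
      fun i hi => by simp [hne i hi], fun i hi j hj => by simp [hne i hi, hne j hj]⟩
  refine ⟨g', ⟨?_, ?_, ?_, ?_⟩⟩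
  · intro i hi
    rcases Finset.mem_insert.1 hi with h | h
    · rw [h, haa]
    · rw [hij i h i h, hg.diag i h]
  · intro i hi j hj
    rcases Finset.mem_insert.1 hi with hi | hi <;> rcases Finset.mem_insert.1 hj with hj | hj
    · rw [hi, hj, haa, ← pderiv_map, hfs]
    · rw [hi, hai j hj, hia j hj, map_star_map_star]
    · rw [hj, hai i hi, hia i hi]
    · rw [hij i hi j hj, hij j hj i hi, hg.star i hi j hj]
  · intro i hi j hj
    rcases Finset.mem_insert.1 hi with hi | hi <;> rcases Finset.mem_insert.1 hj with hj | hj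
    · rw [hi, hj, haa, rayleighDiff_self hf]
    · rw [hi, hai j hj, hia j hj, rayleighDiff_comm, ← hcc j hj, mul_comm]
    · rw [hj, hai i hi, hia i hi, ← hcc i hi]
    · rw [hij i hi j hj, hij j hj i hi, hg.norm i hi j hj]
  · intro i hi j hj k hk l hl
    rcases Finset.mem_insert.1 hi with hi | hi <;> rcases Finset.mem_insert.1 hk with hk | hk
    · rw [hi, hk, mul_comm (g' a l), sub_self]
      exact dvd_zero f
    · rcases Finset.mem_insert.1 hj with hj | hj <;> rcases Finset.mem_insert.1 hl with hl | hl
      · rw [hj, hl, sub_self]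
        exact dvd_zero f
      · rw [hi, hj, haa, hij k hk l hl, hai l hl, hia k hk, mul_comm (map _ _)]
        exact hD k hk l hl
      · rw [hi, hl, haa, hij k hk j hj, hai j hj, hia k hk, dvd_sub_comm, mul_comm (map _ _)]
        exact hD k hk j hj
      · rw [hi, hai j hj, hai l hl, hij k hk l hl, hij k hk j hj, dvd_sub_comm,
          mul_comm _ (g k j)]
        have := hB' j hj l hl k hk
        rwa [mul_comm (g k j)] at this ⊢
    · rcases Finset.mem_insert.1 hj with hj | hj <;> rcases Finset.mem_insert.1 hl with hl | hl
      · rw [hj, hl, sub_self]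
        exact dvd_zero f
      · rw [hk, hj, haa, hij i hi l hl, hai l hl, hia i hi, dvd_sub_comm, mul_comm (g i l)]
        exact hD i hi l hl
      · rw [hk, hl, haa, hij i hi j hj, hai j hj, hia i hi, mul_comm (g i j)]
        exact hD i hi j hj
      · rw [hk, hai j hj, hai l hl, hij i hi l hl, hij i hi j hj, mul_comm (g i l)]
        exact hB' j hj l hl i hi
    · rcases Finset.mem_insert.1 hj with hj | hj <;> rcases Finset.mem_insert.1 hl with hl | hl
      · rw [hj, hl, sub_self]
        exact dvd_zero f
      · rw [hj, hia i hi, hia k hk, hij k hk l hl, hij i hi l hl, dvd_sub_comm]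
        exact hB i hi k hk l hl
      · rw [hl, hia i hi, hia k hk, hij k hk j hj, hij i hi j hj]
        exact hB i hi k hk j hj
      · rw [hij i hi j hj, hij k hk l hl, hij i hi l hl, hij k hk j hj]
        exact hg.minor i hi j hj k hk l hl

end IsHermitianSystem

lemma exists_isHermitianSystem {f : MvPolynomial (Fin m) K} (hf : IsMultiaffine f)
    (hp : Prime f) (hfs : map (starRingEnd K) f = f)
    (hsq : ∀ i j, i ≠ j → ∃ h, rayleighDiff i j f = h * map (starRingEnd K) h)
    (T : Finset (Fin m)) : ∃ g, IsHermitianSystem f T g := by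
  induction T using Finset.induction_on with
  | empty => exact ⟨0, by constructor <;> simp⟩
  | insert a T ha ih =>
    obtain ⟨g, hg⟩ := ih
    exact hg.exists_insert hf hp hfs ha hsq

end Extend

/-! ### Integrating the differential equation to a determinant. -/

section Integrate

variable {K : Type*} [Field K] {m : ℕ}

/-- The substitution `x_l ↦ 0` for all `l ∉ T`. -/
noncomputable def restrictTo (T : Finset (Fin m)) :
    MvPolynomial (Fin m) K →ₐ[K] MvPolynomial (Fin m) K :=
  aeval fun i => if i ∈ T then X i else 0

lemma restrictTo_empty (p : MvPolynomial (Fin m) K) :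
    restrictTo ∅ p = C (constantCoeff p) := by
  simp only [restrictTo, Finset.notMem_empty, if_false, aeval_zero', algebraMap_eq]

lemma restrictTo_univ (p : MvPolynomial (Fin m) K) : restrictTo Finset.univ p = p := by
  simp [restrictTo]

lemma restrictTo_insert {T : Finset (Fin m)} {l : Fin m} (hl : l ∉ T)
    {p : MvPolynomial (Fin m) K} (hp : p.degreeOf l ≤ 1) :
    restrictTo (insert l T) p = restrictTo T p + X l * restrictTo T (pderiv l p) := by
  have key : ∀ q : MvPolynomial (Fin m) K,
      restrictTo (insert l T) (zeroAt l q) = restrictTo T (zeroAt l q) := by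
    intro q
    rw [← AlgHom.comp_apply, ← AlgHom.comp_apply]
    congr 1
    ext i
    by_cases h : i = l
    · subst h; simp [zeroAt]
    · simp [zeroAt, restrictTo, h]
  have hX : restrictTo (insert l T) (X l : MvPolynomial (Fin m) K) = X l := by simp [restrictTo]
  have hX' : restrictTo T (X l : MvPolynomial (Fin m) K) = 0 := by simp [restrictTo, hl]
  conv_lhs => rw [eq_zeroAt_add hp, map_add, map_mul, hX, ← zeroAt_pderiv_self hp, key, key]
  conv_rhs => enter [1]; rw [eq_zeroAt_add hp, map_add, map_mul, hX', zero_mul, add_zero]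
  rw [zeroAt_pderiv_self hp]

-- The variables are switched on one at a time. The matrix identity says `g/f = A(1 + DA)⁻¹` without
-- denominators; it is carried along because the determinant step uses its row `l`.
open Matrix in
lemma IsHermitianSystem.restrictTo_eq_det [StarRing K] {f : MvPolynomial (Fin m) K}
    {g : Fin m → Fin m → MvPolynomial (Fin m) K} (hg : IsHermitianSystem f Finset.univ g)
    (hf : IsMultiaffine f) (h1 : constantCoeff f = 1) (T : Finset (Fin m)) :
    restrictTo T f = det (1 + diagonal (fun i => if i ∈ T then X i else 0) *
        (of fun i j => C (constantCoeff (g i j)))) ∧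
      (of fun i j => restrictTo T (g i j)) *
        (1 + diagonal (fun i => if i ∈ T then X i else 0) *
          (of fun i j => C (constantCoeff (g i j)))) =
        restrictTo T f • (of fun i j => C (constantCoeff (g i j))) := by
  set A : Matrix (Fin m) (Fin m) (MvPolynomial (Fin m) K) :=
    of fun i j => C (constantCoeff (g i j)) with hA
  -- Restriction keeps the constant term 1, so `F` may be cancelled below.
  have hne : ∀ T : Finset (Fin m), restrictTo T f ≠ 0 := by
    intro T h
    have h2 : constantCoeff (restrictTo T f) = constantCoeff f := by
      rw [restrictTo, ← AlgHom.coe_toRingHom, ← RingHom.comp_apply]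
      congr 1
      apply MvPolynomial.ringHom_ext
      · intro r; simp
      · intro i
        by_cases hi : i ∈ T <;> simp [hi]
    rw [h, h1, map_zero] at h2
    exact zero_ne_one h2
  induction T using Finset.induction_on with
  | empty =>
    have hd : diagonal (fun i => if i ∈ (∅ : Finset (Fin m)) then
        (X i : MvPolynomial (Fin m) K) else 0) = 0 := by simp
    rw [hd, zero_mul, add_zero, det_one, mul_one, restrictTo_empty, h1]
    refine ⟨map_one C, ?_⟩
    rw [map_one, one_smul]
    ext i j : 1
    simp [hA, restrictTo_empty]
  | insert l T hl ih =>
    obtain ⟨ihd, ihm⟩ := ih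
    set F := restrictTo T f with hF
    set B : Matrix (Fin m) (Fin m) (MvPolynomial (Fin m) K) :=
      of fun i j => restrictTo T (g i j) with hB
    set M := 1 + diagonal (fun i => if i ∈ T then X i else 0) * A with hM
    have hF0 : F ≠ 0 := hne T
    have hf' : restrictTo (insert l T) f = F + X l * B l l := by
      rw [restrictTo_insert hl (hf l), hB, of_apply, hg.diag l (Finset.mem_univ l)]
    have hg' : ∀ i j, F * restrictTo (insert l T) (g i j) =
        (F + X l * B l l) * B i j - X l * B i l * B l j := by
      intro i j
      have h := congrArg (restrictTo T)
        (hg.mul_pderiv hf (Finset.mem_univ i) (Finset.mem_univ j) (Finset.mem_univ l))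
      rw [restrictTo_insert hl (hg.degreeOf_le hf (Finset.mem_univ i) (Finset.mem_univ j) l)]
      rw [← hg.diag l (Finset.mem_univ l)] at h
      simp only [map_sub, map_mul] at h
      simp only [hB, of_apply]
      linear_combination X l * h
    have hM' : 1 + diagonal (fun i => if i ∈ insert l T then X i else 0) * A =
        updateRow M l (M l + (X l : MvPolynomial (Fin m) K) • A l) := by
      ext i j : 1
      by_cases hi : i = l
      · subst hi
        simp [hM, hl, Matrix.add_apply, diagonal_mul]
      · simp [hM, hi, Matrix.add_apply, diagonal_mul]
    have hrow : F • A l = ∑ k, B l k • M k := by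
      funext j
      have := congrFun (congrFun ihm l) j
      rw [mul_apply] at this
      simp only [Finset.sum_apply, Pi.smul_apply, smul_eq_mul]
      rw [this]
      rfl
    -- Of the combination of rows in `hrow`, only the multiple of row `l` itself contributes to the
    -- determinant.
    have hup : F * det (updateRow M l (A l)) = B l l * F := by
      rw [← det_updateRow_smul, hrow, det_updateRow_sum, ihd, smul_eq_mul]
    constructor
    · rw [hM', det_updateRow_add, det_updateRow_smul, updateRow_eq_self, ← ihd, hf']
      refine mul_left_cancel₀ hF0 ?_
      linear_combination - X l * hup
    · rw [hM', hf']
      ext i j : 1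
      refine mul_left_cancel₀ hF0 ?_
      have e1 : ∀ k, updateRow M l (M l + (X l : MvPolynomial (Fin m) K) • A l) k j =
          M k j + if k = l then X l * A l j else 0 := by
        intro k
        by_cases hk : k = l
        · subst hk; simp
        · simp [hk]
      have hs : ∀ i, ∑ k, B i k * M k j = F * A i j := fun i => by
        rw [← mul_apply, ihm]; rfl
      rw [mul_apply, Finset.mul_sum]
      simp only [e1, of_apply]
      have e2 : ∀ k, F * (restrictTo (insert l T) (g i k) *
          (M k j + if k = l then X l * A l j else 0)) =
          (F + X l * B l l) * (B i k * M k j) - X l * B i l * (B l k * M k j) +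
          if k = l then F * X l * B i l * A l j else 0 := by
        intro k
        rw [← mul_assoc, hg']
        split_ifs with hk
        · subst hk; ring
        · ring
      simp only [e2]
      rw [Finset.sum_add_distrib, Finset.sum_sub_distrib, ← Finset.mul_sum, ← Finset.mul_sum,
        hs, hs, Finset.sum_ite_eq' Finset.univ l, if_pos (Finset.mem_univ l), Matrix.smul_apply,
        smul_eq_mul]
      ring

open Matrix in
/-- The Hermitian matrix whose principal minors are the coefficients of `f`. -/
lemma exists_det_of_prime [StarRing K] {f : MvPolynomial (Fin m) K} (hf : IsMultiaffine f)
    (hp : Prime f) (hfs : map (starRingEnd K) f = f) (h1 : constantCoeff f = 1)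
    (hsq : ∀ i j, i ≠ j → ∃ h, rayleighDiff i j f = h * map (starRingEnd K) h) :
    ∃ A : Matrix (Fin m) (Fin m) K, A.IsHermitian ∧
      f = det (1 + diagonal X * A.map C) ∧ ∀ i, pderiv i f = 0 → ∀ j, A i j = 0 := by
  obtain ⟨g, hg⟩ := exists_isHermitianSystem hf hp hfs hsq Finset.univ
  refine ⟨of fun i j => constantCoeff (g i j), ?_, ?_, ?_⟩
  · ext i j
    rw [conjTranspose_apply, of_apply, of_apply,
      ← hg.star i (Finset.mem_univ i) j (Finset.mem_univ j), constantCoeff_map,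
      starRingEnd_apply, star_star]
  · have := (hg.restrictTo_eq_det hf h1 Finset.univ).1
    rw [restrictTo_univ] at this
    simp only [Finset.mem_univ, if_true] at this
    exact this
  · intro i hi j
    rw [of_apply, hg.eq_zero_of_pderiv_left (Finset.mem_univ i) (Finset.mem_univ j) hi, map_zero]

end Integrate

/-! ### Reduction to irreducible factors. -/

section Factor

variable {K : Type*} [Field K] {m : ℕ}

/-- The conjugate of `g` also divides `f`. If it divided the cofactor `h`, a variable of `g` would
have degree at least two in `f`; so it is associated to `g`, and the constant terms agree. -/
lemma star_eq_of_irreducible_dvd [StarRing K] {f g h : MvPolynomial (Fin m) K}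
    (hf : IsMultiaffine f) (hfs : map (starRingEnd K) f = f) (hf0 : f ≠ 0) (hfgh : f = g * h)
    (hg : Irreducible g) (hg1 : constantCoeff g = 1) : map (starRingEnd K) g = g := by
  have hg0 : g ≠ 0 := hg.ne_zero
  have hh0 : h ≠ 0 := by rintro rfl; simp [hfgh] at hf0
  have hunit : ¬ IsUnit (map (starRingEnd K) g) := fun hu => by
    have := hu.map (map (starRingEnd K))
    rw [map_star_map_star] at this
    exact hg.not_isUnit this
  have hgi : Irreducible (map (starRingEnd K) g) := by
    refine ⟨hunit, fun a b hab => ?_⟩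
    have h2 : g = map (starRingEnd K) a * map (starRingEnd K) b := by
      rw [← map_mul, ← hab, map_star_map_star]
    rcases hg.isUnit_or_isUnit h2 with hu | hu
    · left
      have := hu.map (map (starRingEnd K))
      rwa [map_star_map_star] at this
    · right
      have := hu.map (map (starRingEnd K))
      rwa [map_star_map_star] at this
  have hdvd : map (starRingEnd K) g ∣ g * h := by
    rw [← hfgh, ← hfs, hfgh, map_mul]
    exact dvd_mul_right _ _
  rcases hgi.prime.dvd_or_dvd hdvd with hd | ⟨q, hq⟩
  · obtain ⟨u, hu⟩ := hgi.associated_of_dvd hg hd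
    obtain ⟨c, -, hc⟩ := isUnit_iff_eq_C_of_isReduced.1 u.isUnit
    have h1 := congrArg constantCoeff hu
    rw [map_mul, constantCoeff_map, hg1, hc, constantCoeff_C, map_one, one_mul] at h1
    rw [hc, h1, C_1, mul_one] at hu
    exact hu
  · exfalso
    obtain ⟨l, hl⟩ : ∃ l, g.degreeOf l ≠ 0 := by
      by_contra hall
      push Not at hall
      have hvars : g.vars = ∅ := by
        ext l
        simp [mem_vars_iff_degreeOf_ne_zero, hall l]
      rw [vars_eq_empty_iff_eq_C, ← constantCoeff_eq, hg1, C_1] at hvars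
      exact hg.not_isUnit (hvars ▸ isUnit_one)
    have hq0 : q ≠ 0 := by rintro rfl; simp at hq; exact hh0 hq
    have h1 := hf l
    rw [hfgh, degreeOf_mul_eq hg0 hh0, hq, degreeOf_mul_eq hgi.ne_zero hq0,
      degreeOf_map_of_injective] at h1
    omega

lemma IsMultiaffine.of_mul {g h : MvPolynomial (Fin m) K} (hf : IsMultiaffine (g * h))
    (hg0 : g ≠ 0) (hh0 : h ≠ 0) : IsMultiaffine g ∧ IsMultiaffine h ∧
      ∀ i, pderiv i g = 0 ∨ pderiv i h = 0 := by
  have key : ∀ i, g.degreeOf i + h.degreeOf i ≤ 1 := fun i => by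
    rw [← degreeOf_mul_eq hg0 hh0]; exact hf i
  refine ⟨fun i => by have := key i; omega, fun i => by have := key i; omega, fun i => ?_⟩
  have := key i
  rcases Nat.eq_zero_or_pos (g.degreeOf i) with h1 | h1
  · exact Or.inl (pderiv_eq_zero_of_degreeOf_eq_zero h1)
  · exact Or.inr (pderiv_eq_zero_of_degreeOf_eq_zero (by omega))

/-- If `h` is free of `x_i` and `x_j`, then `Δ_ij(g h) = h² Δ_ij(g)`, and `h²` is the norm of the
self-conjugate `h`. -/
lemma rayleighDiff_norm_of_mul [StarRing K] {g h : MvPolynomial (Fin m) K}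
    (hh0 : h ≠ 0) (hhs : map (starRingEnd K) h = h)
    (hdis : ∀ i, pderiv i g = 0 ∨ pderiv i h = 0) {i j : Fin m}
    (hsq : ∃ q, rayleighDiff i j (g * h) = q * map (starRingEnd K) q) :
    ∃ q, rayleighDiff i j g = q * map (starRingEnd K) q := by
  rcases hdis i with hi | hi
  · exact ⟨0, by rw [rayleighDiff_of_pderiv_eq_zero hi]; simp⟩
  rcases hdis j with hj | hj
  · exact ⟨0, by rw [rayleighDiff_comm, rayleighDiff_of_pderiv_eq_zero hj]; simp⟩
  obtain ⟨q, hq⟩ := hsq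
  refine exists_norm_of_mul_norm (map (starRingEnd K)) map_star_map_star hh0 (h := q) ?_
  rw [← hq, hhs]
  simp only [rayleighDiff, pderiv_mul, hi, hj, mul_zero, add_zero]
  ring

open Matrix

/-- The polynomial `det (1 + diag(x) A)` of a Hermitian matrix `A` supported on the variables
of `f`. -/
def HasPrincipalMinorRep [StarRing K] (f : MvPolynomial (Fin m) K) : Prop :=
  ∃ A : Matrix (Fin m) (Fin m) K, A.IsHermitian ∧
    f = det (1 + diagonal X * A.map C) ∧ ∀ i, pderiv i f = 0 → ∀ j, A i j = 0

/-- Disjoint supports give `A D B = 0`, hence `(1 + DA)(1 + DB) = 1 + D(A + B)`. -/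
lemma HasPrincipalMinorRep.mul [StarRing K] {g h : MvPolynomial (Fin m) K}
    (hg : HasPrincipalMinorRep g) (hh : HasPrincipalMinorRep h) (hg0 : g ≠ 0) (hh0 : h ≠ 0)
    (hdis : ∀ i, pderiv i g = 0 ∨ pderiv i h = 0) : HasPrincipalMinorRep (g * h) := by
  obtain ⟨A, hA, hAd, hAz⟩ := hg
  obtain ⟨B, hB, hBd, hBz⟩ := hh
  refine ⟨A + B, hA.add hB, ?_, ?_⟩
  · have hz : A.map C * (diagonal X * B.map C) = (0 : Matrix _ _ (MvPolynomial (Fin m) K)) := by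
      ext i j : 1
      rw [mul_apply]
      refine Finset.sum_eq_zero fun k _ => ?_
      rw [diagonal_mul, map_apply, map_apply]
      rcases hdis k with hk | hk
      · have : A i k = 0 := by rw [← hA.apply, hAz k hk, star_zero]
        rw [this, C_0, zero_mul]
      · rw [hBz k hk, C_0, mul_zero, mul_zero]
    conv_lhs => rw [hAd, hBd, ← det_mul]
    refine congrArg det ?_
    rw [Matrix.map_add _ (fun a b => C_add), mul_add, mul_add, mul_one, add_mul, one_mul,
      Matrix.mul_assoc, hz, mul_zero, add_zero, add_assoc]
  · intro i hi j
    rw [pderiv_mul] at hi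
    have : pderiv i g = 0 ∧ pderiv i h = 0 := by
      rcases hdis i with h1 | h1
      · rw [h1, zero_mul, zero_add] at hi
        exact ⟨h1, (mul_eq_zero.1 hi).resolve_left hg0⟩
      · rw [h1, mul_zero, add_zero] at hi
        exact ⟨(mul_eq_zero.1 hi).resolve_right hh0, h1⟩
    rw [Matrix.add_apply, hAz i this.1, hBz i this.2, add_zero]

/-- The free scalar `c` lets the induction rescale each irreducible factor to constant term 1. -/
lemma hasPrincipalMinorRep_of_rayleighDiff [StarRing K] (f : MvPolynomial (Fin m) K) :
    ∀ c : K, IsMultiaffine (C c * f) → map (starRingEnd K) (C c * f) = C c * f →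
      constantCoeff (C c * f) = 1 →
      (∀ i j, i ≠ j → ∃ q, rayleighDiff i j (C c * f) = q * map (starRingEnd K) q) →
      HasPrincipalMinorRep (C c * f) := by
  induction f using WfDvdMonoid.induction_on_irreducible with
  | zero => intro c _ _ h1; simp at h1
  | unit u hu =>
    intro c _ _ h1 _
    obtain ⟨r, -, rfl⟩ := isUnit_iff_eq_C_of_isReduced.1 hu
    rw [← C_mul, constantCoeff_C] at h1
    refine ⟨0, isHermitian_zero, ?_, fun _ _ _ => rfl⟩
    rw [← C_mul, h1]
    simp
  | mul a p ha hp ih =>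
    intro c hf hfs h1 hsq
    have h1' := h1
    rw [map_mul, map_mul, constantCoeff_C] at h1'
    set p0 := constantCoeff p with hp0
    have hp0' : p0 ≠ 0 := by rintro h; rw [h] at h1'; simp at h1'
    have hc' : c ≠ 0 := by rintro h; rw [h] at h1'; simp at h1'
    set g := C p0⁻¹ * p with hg
    set h := C (c * p0) * a with hh
    have hfgh : C c * (p * a) = g * h := by
      have : (C p0⁻¹ * C p0 : MvPolynomial (Fin m) K) = 1 := by
        rw [← C_mul, inv_mul_cancel₀ hp0', C_1]
      rw [hg, hh, C_mul]
      linear_combination (- C c * p * a) * this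
    have hu : IsUnit (C p0⁻¹ : MvPolynomial (Fin m) K) := (IsUnit.mk0 _ (inv_ne_zero hp0')).map C
    have hgirr : Irreducible g := by
      rw [hg, irreducible_isUnit_mul hu]
      exact hp
    have hg1 : constantCoeff g = 1 := by
      rw [hg, map_mul, constantCoeff_C, ← hp0, inv_mul_cancel₀ hp0']
    have hh1 : constantCoeff h = 1 := by
      rw [hfgh, map_mul, hg1, one_mul] at h1
      exact h1
    have hg0 : g ≠ 0 := hgirr.ne_zero
    have hh0 : h ≠ 0 := by intro h0; rw [h0, map_zero] at hh1; exact zero_ne_one hh1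
    rw [hfgh] at hf hfs hsq ⊢
    have hgs := star_eq_of_irreducible_dvd hf hfs (mul_ne_zero hg0 hh0) rfl hgirr hg1
    have hhs : map (starRingEnd K) h = h := by
      rw [map_mul, hgs] at hfs
      exact mul_left_cancel₀ hg0 hfs
    obtain ⟨hga, hha, hdis⟩ := hf.of_mul hg0 hh0
    refine HasPrincipalMinorRep.mul ?_ ?_ hg0 hh0 hdis
    · exact exists_det_of_prime hga hgirr.prime hgs hg1
        fun i j hij => rayleighDiff_norm_of_mul hh0 hhs hdis (hsq i j hij)
    · refine ih (c * p0) hha hhs hh1 fun i j hij =>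
        rayleighDiff_norm_of_mul hg0 hgs (fun i => (hdis i).symm) ?_
      rw [mul_comm h g]
      exact hsq i j hij

end Factor

/-! ### Compression to a pencil of size the rank. -/

section Compress

open Matrix

variable {K : Type*} [Field K] {m : ℕ}

/-- A Hermitian matrix of rank `r` is a congruence of one of its nonsingular `r × r` principal
submatrices. -/
lemma exists_eq_mul_mul_conjTranspose [StarRing K] {A : Matrix (Fin m) (Fin m) K}
    (hA : A.IsHermitian) :
    ∃ (r : ℕ) (ι : Fin r → Fin m) (B : Matrix (Fin r) (Fin r) K) (P : Matrix (Fin m) (Fin r) K),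
      B.IsHermitian ∧ IsUnit B.det ∧ P.submatrix ι id = 1 ∧ A = P * B * Pᴴ := by
  -- A basis of the row space is picked among the rows of `A`; `P` holds the coordinates of all rows
  -- in it.
  obtain ⟨r, b, hb, hspan, hli⟩ : ∃ (r : ℕ) (b : Fin r → Fin m → K),
      (∀ k, b k ∈ Set.range A.row) ∧
      Submodule.span K (Set.range b) = Submodule.span K (Set.range A.row) ∧
      LinearIndependent K b :=
    ⟨_, Submodule.exists_fun_fin_finrank_span_eq K (Set.range A.row)⟩
  choose ι hι using hb
  have hex : ∀ i, ∃ c : Fin r → K, ∑ k, c k • b k = A.row i := fun i => by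
    rw [← Submodule.mem_span_range_iff_exists_fun, hspan]
    exact Submodule.subset_span ⟨i, rfl⟩
  choose P hP using hex
  set P' : Matrix (Fin m) (Fin r) K := of P with hP'
  have hrow : A = P' * A.submatrix ι id := by
    ext i j
    have := congrFun (hP i) j
    rw [mul_apply, ← row_apply' A, ← this]
    simp only [Finset.sum_apply, Pi.smul_apply, smul_eq_mul, hP', of_apply, submatrix_apply, id]
    refine Finset.sum_congr rfl fun k _ => ?_
    rw [← hι k]
    rfl
  have hone : P'.submatrix ι id = 1 := by
    ext k l
    have h1 : ∑ k', (P (ι k) k' - (1 : Matrix (Fin r) (Fin r) K) k k') • b k' = 0 := by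
      simp only [sub_smul, Finset.sum_sub_distrib]
      rw [hP, hι]
      simp [one_apply]
    have := Fintype.linearIndependent_iff.1 hli _ h1 l
    exact sub_eq_zero.1 this
  have hB : A.submatrix ι id = A.submatrix ι ι * P'ᴴ := by
    have h1 : A = (A.submatrix ι id)ᴴ * P'ᴴ := by
      conv_lhs => rw [← hA, hrow, conjTranspose_mul]
    conv_lhs => rw [h1]
    rw [conjTranspose_submatrix, hA]
    rfl
  refine ⟨r, ι, A.submatrix ι ι, P', hA.submatrix ι, ?_, hone, ?_⟩
  -- By `hB`, a left null vector of the principal block also annihilates the chosen independent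
  -- rows.
  · rw [← isUnit_iff_isUnit_det, ← linearIndependent_rows_iff_isUnit]
    have hb' : ∀ k, b k = (A.submatrix ι id) k := fun k => (hι k).symm
    rw [Fintype.linearIndependent_iff]
    intro c hc
    refine Fintype.linearIndependent_iff.1 hli c ?_
    have h2 : c ᵥ* A.submatrix ι ι = 0 := by
      rw [← hc]
      ext j
      simp [vecMul, dotProduct]
    have h3 : c ᵥ* A.submatrix ι id = 0 := by rw [hB, ← vecMul_vecMul, h2, zero_vecMul]
    rw [← h3]
    ext j
    simp [vecMul, dotProduct, hb']
  · rw [Matrix.mul_assoc, ← hB]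
    exact hrow

/-- The linear matrix pencil of a determinantal representation. -/
noncomputable def hermitianPencil [StarRing K] {n : ℕ} (v : Fin m → Fin n → K)
    (W : Matrix (Fin n) (Fin n) K) : Matrix (Fin n) (Fin n) (MvPolynomial (Fin m) K) :=
  ∑ i : Fin m, (X i : MvPolynomial (Fin m) K) • (vecMulVec (v i) (star (v i))).map C + W.map C

lemma hermitianPencil_apply [StarRing K] {n : ℕ} (v : Fin m → Fin n → K)
    (W : Matrix (Fin n) (Fin n) K) (k l : Fin n) :
    hermitianPencil v W k l = ∑ i, X i * C (v i k * star (v i l)) + C (W k l) := by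
  rw [hermitianPencil, Matrix.add_apply, Matrix.sum_apply]
  rfl

lemma totalDegree_det_hermitianPencil_le [StarRing K] {n : ℕ} (v : Fin m → Fin n → K)
    (W : Matrix (Fin n) (Fin n) K) : (hermitianPencil v W).det.totalDegree ≤ n := by
  have he : ∀ k l, (hermitianPencil v W k l).totalDegree ≤ 1 := by
    intro k l
    rw [hermitianPencil_apply]
    refine (totalDegree_add _ _).trans (max_le (totalDegree_finsetSum_le fun i _ => ?_) ?_)
    · refine (totalDegree_mul _ _).trans ?_
      rw [totalDegree_X, totalDegree_C]
    · rw [totalDegree_C]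
      exact zero_le_one
  rw [det_apply]
  refine totalDegree_finsetSum_le fun σ _ => (totalDegree_smul_le _ _).trans
    ((totalDegree_finsetProd _ _).trans ?_)
  calc ∑ i, (hermitianPencil v W (σ i) i).totalDegree ≤ ∑ _i : Fin n, 1 :=
        Finset.sum_le_sum fun i _ => he _ _
    _ = n := by simp

/-- If the vectors `v i` contain the standard basis, the determinant of the pencil has degree
equal to its size. -/
lemma le_totalDegree_det_hermitianPencil [StarRing K] {n : ℕ} (v : Fin m → Fin n → K)
    (W : Matrix (Fin n) (Fin n) K) (ι : Fin n → Fin m) (hι : ∀ k, v (ι k) = Pi.single k 1) :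
    n ≤ (hermitianPencil v W).det.totalDegree := by
  classical
  have hinj : Function.Injective ι := by
    intro k l hkl
    by_contra hne
    have := congrFun (hι k) k
    rw [hkl, hι, Pi.single_eq_same, Pi.single_eq_of_ne hne] at this
    exact zero_ne_one this
  -- Putting one variable `t` for the `x_{ι k}` and 0 for the others turns the pencil into `t + W`,
  -- whose determinant is monic of degree `n`.
  set φ : Fin m → Polynomial K := fun i => if i ∈ Set.range ι then Polynomial.X else 0 with hφ
  have h1 : Polynomial.natDegree (aeval φ (hermitianPencil v W).det) ≤
      (hermitianPencil v W).det.totalDegree * 1 := by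
    refine aeval_natDegree_le _ le_rfl _ fun i => ?_
    simp only [hφ]
    split_ifs
    · exact Polynomial.natDegree_X_le
    · simp
  have h2 : aeval φ (hermitianPencil v W).det = (-W).charpoly := by
    rw [AlgHom.map_det, charpoly]
    congr 1
    ext k l : 1
    rw [AlgHom.mapMatrix_apply, map_apply, hermitianPencil_apply, map_add, map_sum]
    have h3 : ∑ i, aeval φ (X i * C (v i k * star (v i l))) =
        if k = l then Polynomial.X else 0 := by
      rw [← Finset.sum_subset (Finset.subset_univ (Finset.univ.image ι))]
      · rw [Finset.sum_image fun a _ b _ h => hinj h]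
        have h4 : ∀ x, aeval φ (X (ι x) * C (v (ι x) k * star (v (ι x) l))) =
            if k = x then (if k = l then Polynomial.X else 0) else 0 := by
          intro x
          rw [map_mul, aeval_X, algHom_C, hι]
          simp only [hφ, Set.mem_range_self, if_true]
          by_cases hk : k = x
          · subst hk
            by_cases hl : k = l
            · subst hl; simp
            · rw [Pi.single_eq_same, Pi.single_eq_of_ne (Ne.symm hl)]
              simp [hl]
          · rw [Pi.single_eq_of_ne hk]
            simp [hk]
        simp only [h4]
        simp
      · intro i _ hi
        have : i ∉ Set.range ι := by simpa using hi
        rw [map_mul, aeval_X]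
        simp only [hφ]
        rw [if_neg this, zero_mul]
    rw [h3, algHom_C]
    by_cases hkl : k = l
    · subst hkl; simp [charmatrix_apply_eq]
    · simp [hkl, charmatrix_apply_ne]
  rw [h2, charpoly_natDegree_eq_dim, Fintype.card_fin, mul_one] at h1
  exact h1

/-- `det (1 + diag(x) A)` as the determinant of a pencil whose size is the rank of `A`. -/
lemma exists_det_eq_hermitianPencil [StarRing K] {A : Matrix (Fin m) (Fin m) K}
    (hA : A.IsHermitian) : ∃ (r : ℕ) (ι : Fin r → Fin m) (d : K) (v : Fin m → Fin r → K)
      (W : Matrix (Fin r) (Fin r) K), W.IsHermitian ∧ (∀ k, v (ι k) = Pi.single k 1) ∧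
      star d = d ∧ d ≠ 0 ∧
      (1 + diagonal X * A.map C : Matrix _ _ (MvPolynomial (Fin m) K)).det =
        C d * (hermitianPencil v W).det := by
  obtain ⟨r, ι, B, P, hB, hdet, hone, rfl⟩ := exists_eq_mul_mul_conjTranspose hA
  -- `det(1 + D P B P^*) = det(1 + B P^* D P) = det B · det(P^* D P + B⁻¹)`.
  refine ⟨r, ι, B.det, fun i k => star (P i k), B⁻¹, hB.inv, ?_, ?_, hdet.ne_zero, ?_⟩
  · intro k
    ext l
    have := congrFun (congrFun hone k) l
    rw [submatrix_apply, id] at this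
    change star (P (ι k) l) = _
    rw [this, one_apply, Pi.single_apply]
    by_cases h : k = l
    · simp [h]
    · simp [h, Ne.symm h]
  · rw [← det_conjTranspose, hB]
  · have hpen : hermitianPencil (fun i k => star (P i k)) B⁻¹ =
        (Matrix.map Pᴴ C : Matrix (Fin r) (Fin m) (MvPolynomial (Fin m) K)) *
          (diagonal X : Matrix (Fin m) (Fin m) (MvPolynomial (Fin m) K)) *
          (P.map C : Matrix (Fin m) (Fin r) (MvPolynomial (Fin m) K)) + B⁻¹.map C := by
      ext k l : 1
      rw [hermitianPencil_apply, Matrix.add_apply, mul_apply, map_apply]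
      congr 1
      refine Finset.sum_congr rfl fun i _ => ?_
      rw [mul_diagonal, map_apply, map_apply, conjTranspose_apply, star_star, C_mul]
      ring
    have hBdet : (C B.det : MvPolynomial (Fin m) K) = (B.map C).det := by
      rw [← RingHom.mapMatrix_apply, ← RingHom.map_det]
    have hBB : B.map C * B⁻¹.map C = (1 : Matrix _ _ (MvPolynomial (Fin m) K)) := by
      rw [← Matrix.map_mul, mul_nonsing_inv _ hdet, Matrix.map_one _ C_0 C_1]
    have hmap : ((P * B * Pᴴ).map C : Matrix (Fin m) (Fin m) (MvPolynomial (Fin m) K)) =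
        (P.map C : Matrix (Fin m) (Fin r) (MvPolynomial (Fin m) K)) *
          ((B.map C : Matrix (Fin r) (Fin r) (MvPolynomial (Fin m) K)) *
            (Matrix.map Pᴴ C : Matrix (Fin r) (Fin m) (MvPolynomial (Fin m) K))) := by
      rw [Matrix.map_mul, Matrix.map_mul, Matrix.mul_assoc]
    rw [hmap, ← Matrix.mul_assoc, det_one_add_mul_comm, hBdet, ← det_mul, hpen, mul_add, hBB,
      add_comm]
    simp only [Matrix.mul_assoc]

end Compress

/-! ### Determinants of rank-two updates. -/

section RankTwoUpdate

open Matrix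

variable {n : ℕ}

/-- Swapping the factors in `det(1 + UV) = det(1 + VU)` leaves a 2 × 2 determinant. -/
lemma det_add_vecMulVec_add_vecMulVec {E : Type*} [Field E] (M : Matrix (Fin n) (Fin n) E)
    (hM : IsUnit M.det) (u u' w w' : Fin n → E) :
    (M + vecMulVec u u' + vecMulVec w w').det = M.det *
      ((1 + u' ⬝ᵥ M⁻¹ *ᵥ u) * (1 + w' ⬝ᵥ M⁻¹ *ᵥ w) -
        (u' ⬝ᵥ M⁻¹ *ᵥ w) * (w' ⬝ᵥ M⁻¹ *ᵥ u)) := by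
  set U : Matrix (Fin n) (Fin 2) E := of fun k a => ![u, w] a k with hU
  set V : Matrix (Fin 2) (Fin n) E := of fun a k => ![u', w'] a k with hV
  have h1 : M + vecMulVec u u' + vecMulVec w w' = M * (1 + (M⁻¹ * U) * V) := by
    rw [mul_add, mul_one, ← Matrix.mul_assoc, ← Matrix.mul_assoc, mul_nonsing_inv _ hM,
      Matrix.one_mul, add_assoc]
    refine congrArg (M + ·) ?_
    ext k l
    simp [hU, hV, mul_apply, vecMulVec_apply, Fin.sum_univ_two]
  have h2 : ∀ a b, (V * (M⁻¹ * U)) a b = ![u', w'] a ⬝ᵥ M⁻¹ *ᵥ ![u, w] b := by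
    intro a b
    rfl
  rw [h1, det_mul, det_one_add_mul_comm, det_fin_two]
  simp [Matrix.add_apply, h2]

/-- Over the fraction field `M` is invertible with `adj M = det M · M⁻¹`, and the identity becomes
the preceding 2 × 2 expansion. -/
lemma det_mul_det_add_vecMulVec {R : Type*} [CommRing R] [IsDomain R]
    (M : Matrix (Fin n) (Fin n) R) (hM : M.det ≠ 0) (u u' w w' : Fin n → R) :
    M.det * (M + vecMulVec u u' + vecMulVec w w').det =
      (M + vecMulVec u u').det * (M + vecMulVec w w').det -
        (u' ⬝ᵥ M.adjugate *ᵥ w) * (w' ⬝ᵥ M.adjugate *ᵥ u) := by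
  set φ := algebraMap R (FractionRing R) with hφ
  have hinj : Function.Injective φ := IsFractionRing.injective R (FractionRing R)
  apply hinj
  have hu : IsUnit (M.map φ).det := by
    rw [isUnit_iff_ne_zero, ← RingHom.mapMatrix_apply, ← RingHom.map_det]
    exact (map_ne_zero_iff φ hinj).2 hM
  have hv : ∀ a b : Fin n → R, (vecMulVec a b).map φ = vecMulVec (φ ∘ a) (φ ∘ b) := by
    intro a b
    ext k l
    simp [vecMulVec_apply]
  have hd : ∀ a b : Fin n → R, φ (a ⬝ᵥ M.adjugate *ᵥ b) =
      (M.map φ).det * ((φ ∘ a) ⬝ᵥ (M.map φ)⁻¹ *ᵥ (φ ∘ b)) := by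
    intro a b
    have : (M.map φ).adjugate = (M.map φ).det • (M.map φ)⁻¹ := by
      rw [inv_def, smul_smul, Ring.mul_inverse_cancel _ hu, one_smul]
    rw [← smul_eq_mul, ← dotProduct_smul, ← smul_mulVec, ← this, ← RingHom.mapMatrix_apply,
      ← RingHom.map_adjugate, RingHom.map_dotProduct]
    refine congrArg (dotProduct _) ?_
    funext k
    rw [Function.comp_apply, RingHom.map_mulVec]
    rfl
  have h1 : ∀ a b : Fin n → FractionRing R, (M.map φ + vecMulVec a b).det =
      (M.map φ).det * (1 + b ⬝ᵥ (M.map φ)⁻¹ *ᵥ a) := by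
    intro a b
    have := det_add_vecMulVec_add_vecMulVec (M.map φ) hu a b 0 0
    simpa using this
  have hm : ∀ A B : Matrix (Fin n) (Fin n) R, (A + B).map φ = A.map φ + B.map φ :=
    fun A B => Matrix.map_add _ (map_add φ) A B
  simp only [map_mul, map_sub, hd, RingHom.map_det, RingHom.mapMatrix_apply, hm, hv, h1]
  rw [det_add_vecMulVec_add_vecMulVec _ hu]
  ring

end RankTwoUpdate

/-! ### Translation of the variables. -/

section Translate

variable {K : Type*} [Field K] {m : ℕ}

/-- The translation `x ↦ x + a`. -/
noncomputable def translateVars (a : Fin m → K) :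
    MvPolynomial (Fin m) K →ₐ[K] MvPolynomial (Fin m) K :=
  aeval fun k => X k + C (a k)

lemma translate_X (a : Fin m → K) (k : Fin m) : translateVars a (X k) = X k + C (a k) := by
  simp [translateVars]

lemma translate_injective (a : Fin m → K) : Function.Injective (translateVars a) := by
  have h : (translateVars (-a)).comp (translateVars a) = AlgHom.id K (MvPolynomial (Fin m) K) := by
    ext k : 1
    simp [translateVars]
  intro p q hpq
  rw [← AlgHom.id_apply (R := K) p, ← AlgHom.id_apply (R := K) q, ← h, AlgHom.comp_apply, hpq,
    AlgHom.comp_apply]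

lemma degreeOf_translate_eq_zero (a : Fin m → K) {i : Fin m} {p : MvPolynomial (Fin m) K}
    (hp : p.degreeOf i = 0) : (translateVars a p).degreeOf i = 0 := by
  apply degreeOf_eq_zero_of_zeroAt
  rw [← zeroAt_of_degreeOf_eq_zero hp, ← AlgHom.comp_apply, ← AlgHom.comp_apply,
    ← AlgHom.comp_apply]
  congr 1
  ext k : 1
  by_cases hk : k = i
  · subst hk; simp [zeroAt]
  · simp [zeroAt, translateVars, hk]

lemma translate_eq (a : Fin m → K) {i : Fin m} {p : MvPolynomial (Fin m) K}
    (hp : p.degreeOf i ≤ 1) : translateVars a p = translateVars a (zeroAt i p) +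
      (X i + C (a i)) * translateVars a (pderiv i p) := by
  conv_lhs => rw [eq_zeroAt_add hp, map_add, map_mul, translate_X]

lemma degreeOf_zeroAt_self (i : Fin m) (p : MvPolynomial (Fin m) K) :
    (zeroAt i p).degreeOf i = 0 :=
  degreeOf_eq_zero_of_zeroAt (zeroAt_zeroAt i p)

lemma degreeOf_translate_le_one (a : Fin m → K) {i : Fin m} {p : MvPolynomial (Fin m) K}
    (hp : p.degreeOf i ≤ 1) : (translateVars a p).degreeOf i ≤ 1 := by
  rw [translate_eq a hp]
  have h1 := degreeOf_translate_eq_zero a (degreeOf_zeroAt_self i p)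
  have h2 := degreeOf_translate_eq_zero a (degreeOf_pderiv_self hp)
  refine (degreeOf_add_le _ _ _).trans (max_le (by omega) ((degreeOf_mul_le _ _ _).trans ?_))
  have h3 : (X i + C (a i) : MvPolynomial (Fin m) K).degreeOf i ≤ 1 :=
    (degreeOf_add_le _ _ _).trans (by simp)
  omega

lemma pderiv_translate (a : Fin m → K) {i : Fin m} {p : MvPolynomial (Fin m) K}
    (hp : p.degreeOf i ≤ 1) : pderiv i (translateVars a p) = translateVars a (pderiv i p) := by
  rw [translate_eq a hp, map_add, pderiv_mul, map_add, pderiv_X_self, pderiv_C,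
    pderiv_eq_zero_of_degreeOf_eq_zero (degreeOf_translate_eq_zero a (degreeOf_zeroAt_self i p)),
    pderiv_eq_zero_of_degreeOf_eq_zero (degreeOf_translate_eq_zero a (degreeOf_pderiv_self hp))]
  ring

lemma rayleighDiff_C_mul_translate (a : Fin m → K) (c : K) {p : MvPolynomial (Fin m) K}
    (hp : IsMultiaffine p) (i j : Fin m) :
    rayleighDiff i j (C c * translateVars a p) = C c * C c * translateVars a (rayleighDiff i j p) := by
  rw [rayleighDiff, rayleighDiff, pderiv_C_mul, pderiv_C_mul, pderiv_C_mul,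
    pderiv_translate a (hp i), pderiv_translate a (hp j),
    pderiv_translate a ((degreeOf_pderiv_le i j p).trans (hp i)), map_sub, map_mul, map_mul]
  ring

lemma constantCoeff_translate (a : Fin m → K) (p : MvPolynomial (Fin m) K) :
    constantCoeff (translateVars a p) = eval a p := by
  rw [translateVars, ← AlgHom.coe_toRingHom, ← RingHom.comp_apply]
  congr 1
  apply MvPolynomial.ringHom_ext
  · intro r; simp
  · intro k; simp

lemma map_star_translate [StarRing K] {a : Fin m → K} (ha : ∀ i, star (a i) = a i)
    (p : MvPolynomial (Fin m) K) :
    map (starRingEnd K) (translateVars a p) = translateVars a (map (starRingEnd K) p) := by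
  rw [← AlgHom.coe_toRingHom, ← RingHom.comp_apply, ← RingHom.comp_apply]
  congr 1
  apply MvPolynomial.ringHom_ext
  · intro r
    simp
  · intro k
    simp [translateVars, starRingEnd_apply, ha]

open Matrix in
lemma translate_hermitianPencil [StarRing K] {n : ℕ} (a : Fin m → K) (v : Fin m → Fin n → K)
    (W : Matrix (Fin n) (Fin n) K) : (translateVars a).mapMatrix (hermitianPencil v W) =
      hermitianPencil v (W + ∑ i, a i • vecMulVec (v i) (star (v i))) := by
  ext k l : 1
  rw [AlgHom.mapMatrix_apply, map_apply, hermitianPencil_apply, hermitianPencil_apply, map_add,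
    map_sum, Matrix.add_apply, Matrix.sum_apply, C_add, map_sum, algHom_C, ← add_assoc,
    add_right_comm, ← Finset.sum_add_distrib, algebraMap_eq]
  congr 1
  refine Finset.sum_congr rfl fun i _ => ?_
  rw [map_mul, translate_X, algHom_C, algebraMap_eq, Matrix.smul_apply, vecMulVec_apply,
    smul_eq_mul, C_mul]
  simp only [Pi.star_apply, C_mul]
  ring

end Translate

/-! ### Necessity: determinants have Hermitian square Rayleigh differences. -/

section Forward

open Matrix

variable {K : Type*} [Field K] [StarRing K] {m : ℕ}

lemma map_star_hermitianPencil {n : ℕ} (v : Fin m → Fin n → K)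
    {W : Matrix (Fin n) (Fin n) K} (hW : W.IsHermitian) :
    (map (starRingEnd K)).mapMatrix (hermitianPencil v W) = (hermitianPencil v W)ᵀ := by
  ext k l : 1
  rw [RingHom.mapMatrix_apply, map_apply, transpose_apply, hermitianPencil_apply,
    hermitianPencil_apply, map_add, map_sum, map_C, starRingEnd_apply, hW.apply]
  congr 1
  refine Finset.sum_congr rfl fun i _ => ?_
  rw [map_mul, map_X, map_C, map_mul, starRingEnd_apply, starRingEnd_apply, star_star, mul_comm]
  simp [mul_comm]

/-- The Rayleigh differences of a determinant of a Hermitian pencil are Hermitian squares. -/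
lemma rayleighDiff_det_hermitianPencil {p : MvPolynomial (Fin m) K} (hp : IsMultiaffine p)
    {lam : K} (hlam : star lam = lam) {n : ℕ} (v : Fin m → Fin n → K)
    {W : Matrix (Fin n) (Fin n) K} (hW : W.IsHermitian)
    (h : p = C lam * (hermitianPencil v W).det) (i j : Fin m) :
    ∃ q, rayleighDiff i j p = q * map (starRingEnd K) q := by
  set M := hermitianPencil v W with hM
  by_cases hdet : M.det = 0
  · refine ⟨0, ?_⟩
    rw [h, hdet]
    simp [rayleighDiff]
  set u : Fin m → Fin n → MvPolynomial (Fin m) K := fun i k => C (v i k) with hu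
  set u' : Fin m → Fin n → MvPolynomial (Fin m) K := fun i k => C (star (v i k)) with hu'
  -- Conjugation transposes the Hermitian pencil and its adjugate, so it exchanges `i` and `j` in
  -- the adjugate form.
  have hsM : (map (starRingEnd K)).mapMatrix M.adjugate = M.adjugateᵀ := by
    rw [RingHom.map_adjugate, map_star_hermitianPencil v hW, adjugate_transpose]
  have hconj : map (starRingEnd K) (u' i ⬝ᵥ M.adjugate *ᵥ u j) =
      u' j ⬝ᵥ M.adjugate *ᵥ u i := by
    have e1 : (map (starRingEnd K) ∘ u' i) = u i := by
      funext k; simp [hu, hu', starRingEnd_apply]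
    have e2 : (map (starRingEnd K) ∘ u j) = u' j := by
      funext k; simp [hu, hu', starRingEnd_apply]
    have e3 : (map (starRingEnd K) ∘ (M.adjugate *ᵥ u j)) = M.adjugateᵀ *ᵥ u' j := by
      funext k
      rw [Function.comp_apply, RingHom.map_mulVec, ← RingHom.mapMatrix_apply, hsM, e2]
    rw [RingHom.map_dotProduct, e1, e3, mulVec_transpose, dotProduct_comm, dotProduct_mulVec]
  have hshift : ∀ l (W' : Matrix (Fin n) (Fin n) K),
      (translateVars (Pi.single l 1)).mapMatrix (hermitianPencil v W') =
        hermitianPencil v W' + vecMulVec (u l) (u' l) := by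
    intro l W'
    rw [translate_hermitianPencil]
    ext k k' : 1
    rw [Matrix.add_apply, hermitianPencil_apply, hermitianPencil_apply, Matrix.add_apply,
      Matrix.sum_apply, C_add, ← add_assoc]
    congr 1
    rw [Finset.sum_eq_single l (fun b _ hb => by simp [Pi.single_eq_of_ne hb]) (by simp)]
    simp [vecMulVec_apply, hu, hu']
  have hone : ∀ l {q : MvPolynomial (Fin m) K}, q.degreeOf l ≤ 1 →
      translateVars (Pi.single l 1) q = q + pderiv l q := by
    intro l q hq
    have key : ∀ r : MvPolynomial (Fin m) K,
        translateVars (Pi.single l 1) (zeroAt l r) = zeroAt l r := by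
      intro r
      rw [← AlgHom.comp_apply]
      congr 1
      ext k : 1
      by_cases hk : k = l
      · subst hk; simp [zeroAt]
      · simp [zeroAt, translateVars, hk]
    rw [translate_eq _ hq, key, ← zeroAt_pderiv_self hq, key, zeroAt_pderiv_self hq,
      Pi.single_eq_same, C_1]
    conv_rhs => enter [1]; rw [eq_zeroAt_add hq]
    ring
  have h1 : ∀ l, p + pderiv l p = C lam * (M + vecMulVec (u l) (u' l)).det := by
    intro l
    rw [← hone l (hp l), h, map_mul, AlgHom.map_det, hshift, algHom_C]
    rfl
  have hvv : (translateVars (Pi.single i 1)).mapMatrix (vecMulVec (u j) (u' j)) =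
      vecMulVec (u j) (u' j) := by
    ext k k' : 1
    rw [AlgHom.mapMatrix_apply, map_apply, vecMulVec_apply]
    simp only [hu, hu']
    rw [← C_mul, algHom_C, algebraMap_eq]
  have h2 : p + pderiv i p + (pderiv j p + pderiv i (pderiv j p)) =
      C lam * (M + vecMulVec (u i) (u' i) + vecMulVec (u j) (u' j)).det := by
    rw [← hone i (hp i), ← hone i ((degreeOf_pderiv_le i j p).trans (hp i)), ← map_add, h1 j,
      map_mul, AlgHom.map_det, map_add, hshift, hvv, algHom_C]
    rfl
  have h3 := det_mul_det_add_vecMulVec M hdet (u i) (u' i) (u j) (u' j)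
  refine ⟨C lam * (u' i ⬝ᵥ M.adjugate *ᵥ u j), ?_⟩
  rw [map_mul, hconj, map_C, starRingEnd_apply, hlam, rayleighDiff]
  -- `Δ_ij` is a 2 × 2 determinant in the values of `p` at the four unit shifts in `x_i` and `x_j`.
  have h4 : pderiv i p * pderiv j p - p * pderiv i (pderiv j p) =
      (p + pderiv i p) * (p + pderiv j p) -
        p * (p + pderiv i p + (pderiv j p + pderiv i (pderiv j p))) := by ring
  rw [h4, h2, h1, h1, h]
  linear_combination (-C lam * C lam) * h3

end Forward

/-! ### Sufficiency, with the size equal to the degree. -/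

section Backward

open Matrix

variable {K : Type*} [Field K] [StarRing K] {m : ℕ}

lemma exists_hermitianPencil_of_rayleighDiff {p : MvPolynomial (Fin m) K}
    (hp : IsMultiaffine p) (hps : map (starRingEnd K) p = p) {a : Fin m → K}
    (ha : ∀ i, star (a i) = a i) (hpa : eval a p ≠ 0)
    (hsq : ∀ i j, i ≠ j → ∃ q, rayleighDiff i j p = q * map (starRingEnd K) q) :
    ∃ (lam : K) (v : Fin m → Fin p.totalDegree → K)
      (W : Matrix (Fin p.totalDegree) (Fin p.totalDegree) K), star lam = lam ∧ W.IsHermitian ∧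
      p = C lam * (hermitianPencil v W).det := by
  set c := eval a p with hc
  have hcs : star c = c := by
    have h := map_eval (starRingEnd K) a p
    have e : (starRingEnd K) ∘ a = a := funext ha
    rw [e, hps] at h
    exact h
  have hcs' : star c⁻¹ = c⁻¹ := by rw [star_inv₀, hcs]
  obtain ⟨A, hA, hdet, -⟩ := hasPrincipalMinorRep_of_rayleighDiff (translateVars a p) c⁻¹
    (fun i => (degreeOf_C_mul_le _ _ _).trans (degreeOf_translate_le_one a (hp i)))
    (by rw [map_mul, map_C, starRingEnd_apply, hcs', map_star_translate ha, hps])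
    (by rw [map_mul, constantCoeff_C, constantCoeff_translate, ← hc, inv_mul_cancel₀ hpa])
    (fun i j hij => by
      obtain ⟨q, hq⟩ := hsq i j hij
      refine ⟨C c⁻¹ * translateVars a q, ?_⟩
      rw [rayleighDiff_C_mul_translate a _ hp, hq, map_mul, map_mul, map_C, starRingEnd_apply,
        hcs', map_star_translate ha]
      ring)
  obtain ⟨r, ι, d, v, W, hW, hι, hds, hd, hdet'⟩ := exists_det_eq_hermitianPencil hA
  -- The translation by `a` is undone inside the constant term of the pencil.
  set W' := W - ∑ i, a i • vecMulVec (v i) (star (v i)) with hW'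
  have hWH : W'.IsHermitian := by
    refine hW.sub ?_
    ext k l
    rw [conjTranspose_apply, Matrix.sum_apply, Matrix.sum_apply, star_sum]
    refine Finset.sum_congr rfl fun i _ => ?_
    simp [vecMulVec_apply, ha, mul_comm]
  have hrep : p = C (c * d) * (hermitianPencil v W').det := by
    apply translate_injective a
    rw [map_mul, AlgHom.map_det, translate_hermitianPencil, hW', sub_add_cancel, algHom_C,
      algebraMap_eq, C_mul, mul_assoc, ← hdet', ← hdet, ← mul_assoc, ← C_mul,
      mul_inv_cancel₀ hpa, C_1, one_mul]
  have hdet0 : (hermitianPencil v W').det ≠ 0 := by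
    intro h0
    rw [h0, mul_zero] at hrep
    rw [hc, hrep, map_zero] at hpa
    exact hpa rfl
  have hdeg : p.totalDegree = r := by
    rw [hrep, totalDegree_mul_of_isDomain (by simpa using ⟨hpa, hd⟩) hdet0, totalDegree_C,
      zero_add]
    exact le_antisymm (totalDegree_det_hermitianPencil_le v W')
      (le_totalDegree_det_hermitianPencil v W' ι hι)
  rw [hdeg]
  exact ⟨c * d, v, W', by rw [star_mul, hcs, hds, mul_comm], hWH, hrep⟩

end Backward

/-- Degree at most one in each variable makes the grid `{0, 1}^m` sufficient, even over a field of
two elements. -/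
lemma exists_eval_ne_zero {F : Type*} [Field F] {m : ℕ} {f : MvPolynomial (Fin m) F}
    (hf : IsMultiaffine f) (h0 : f ≠ 0) : ∃ a : Fin m → F, eval a f ≠ 0 := by
  classical
  by_contra h
  push Not at h
  refine h0 (eq_zero_of_eval_zero_at_prod_finset f (fun _ => {0, 1}) (fun i => ?_) fun x _ => h x)
  rw [Finset.card_pair zero_ne_one]
  exact Nat.lt_succ_of_le (hf i)

lemma map_rayleighDiff {F K : Type*} [Field F] [Field K] (φ : F →+* K) {m : ℕ}
    (f : MvPolynomial (Fin m) F) (i j : Fin m) :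
    map φ (rayleighDiff i j f) = rayleighDiff i j (map φ f) := by
  simp only [rayleighDiff, map_sub, map_mul, pderiv_map]

theorem theorem5p5 {F K : Type*} [Field F] [Field K] [Algebra F K] [StarRing K]
    (hfix : ∀ a : K, star a = a ↔ a ∈ Set.range (algebraMap F K))
    (hord : ∃ a : K, star a ≠ a)
    (m : ℕ) (f : MvPolynomial (Fin m) F) (hf : IsMultiaffine f) :
    ((∃ n : ℕ, HasHermitianDetRep K f n) ↔
      ∀ i j : Fin m, IsHermitianSquare K (rayleighDiff i j f)) ∧
    ((∃ n : ℕ, HasHermitianDetRep K f n) → HasHermitianDetRep K f f.totalDegree) := by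
  have hstar : ∀ a : F, star (algebraMap F K a) = algebraMap F K a :=
    fun a => (hfix _).2 ⟨a, rfl⟩
  set p := map (algebraMap F K) f with hp
  have hpm : IsMultiaffine p := fun i => by
    rw [hp, degreeOf_map_of_injective]
    exact hf i
  have hps : map (starRingEnd K) p = p := by
    rw [hp, map_map]
    exact congrArg (fun φ => map φ f) (RingHom.ext hstar)
  have hforward : (∃ n : ℕ, HasHermitianDetRep K f n) →
      ∀ i j : Fin m, IsHermitianSquare K (rayleighDiff i j f) := by
    rintro ⟨n, lam, v, W, hW, hrep⟩ i j
    rw [IsHermitianSquare, map_rayleighDiff]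
    exact rayleighDiff_det_hermitianPencil hpm (hstar lam) v hW hrep i j
  have hbackward : (∀ i j : Fin m, IsHermitianSquare K (rayleighDiff i j f)) →
      HasHermitianDetRep K f f.totalDegree := by
    intro hsq
    by_cases h0 : f = 0
    · refine ⟨0, fun _ _ => 0, 0, Matrix.isHermitian_zero, ?_⟩
      rw [h0, map_zero, map_zero, C_0, zero_mul]
    -- The point is taken over `F`, so that translating by it commutes with the involution.
    · obtain ⟨a, ha⟩ := exists_eval_ne_zero hf h0
      have hdeg : p.totalDegree = f.totalDegree := by
        rw [totalDegree, totalDegree, hp,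
          support_map_of_injective _ (algebraMap F K).injective]
      obtain ⟨lam, v, W, hlam, hW, hrep⟩ := exists_hermitianPencil_of_rayleighDiff hpm hps
        (a := algebraMap F K ∘ a) (fun i => hstar (a i))
        (by
          rw [hp, ← map_eval]
          exact (map_ne_zero _).2 ha)
        (fun i j _ => by
          obtain ⟨q, hq⟩ := hsq i j
          exact ⟨q, by rw [← map_rayleighDiff, hq]⟩)
      obtain ⟨lam', rfl⟩ := (hfix lam).1 hlam
      rw [← hdeg]
      exact ⟨lam', v, W, hW, hrep⟩
  exact ⟨⟨hforward, fun h => ⟨_, hbackward h⟩⟩, fun h => hbackward (hforward h)⟩
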